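/- Let $\Gamma$ be a set (the lattice, for example $\mathbb Z^\nu$), and let $\mathcal A$ be a unital $C^*$-algebra which is one of the following. (a) A quantum spin lattice system on $\Gamma$: to every finite $I\subset\Gamma$ there belongs a unital $*$-subalgebra $\mathcal A(I)\subset\mathcal A$ isomorphic to a full matrix algebra $M_{k}(\mathbb C)$, with $k$ depending on $I$; for disjoint $I,J$ one has $\mathcal A(I\cup J)=\mathcal A(I)\otimes\mathcal A(J)$ (the two subalgebras commute and multiplication induces an isomorphism $\mathcal A(I)\otimes\mathcal A(J)\to\mathcal A(I\cup J)$); and $\bigcup_I\mathcal A(I)$ is norm dense in $\mathcal A$. (b) A fermion lattice system on $\Gamma$: there are $c_i\in\mathcal A$ ($i\in\Gamma$) with $\{c_i^*,c_j\}=\delta_{ij}\mathbf 1$ and $\{c_i,c_j\}=0$; $\mathcal A(I)$ is the $*$-algebra generated by $\{c_i : i\in I\}$, which is isomorphic to $M_{2^{|I|}}(\mathbb C)$; and $\bigcup_I\mathcal A(I)$ is norm dense in $\mathcal A$. A state is even if it is invariant under the $*$-automorphism $\Theta$ of $\mathcal A$ with $\Theta(c_i)=-c_i$. For a state $\rho$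 of $\mathcal A$ and a finite $I\subset\Gamma$ let $S_I(\rho)=-\mathrm{Tr}(D\log D)$, where $D$ is the density matrix of $\rho|_{\mathcal A(I)}$ with respect to the matrix trace $\mathrm{Tr}$ of $\mathcal A(I)$. For $J\subset\Gamma\setminus I$, finite or infinite, put $$\widetilde S_{I|J}(\rho)=\inf_{\Lambda\subset J,\ \Lambda\ \text{finite}}\bigl\{S_{I\cup\Lambda}(\rho)-S_\Lambda(\rho)\bigr\},\qquad I_\rho(I:J)=S_I(\rho)-\widetilde S_{I|J}(\rho).$$ Let $\mathcal F_b$ be any family of finite subsets of $\Gamma$ (for example all boxes in $\mathbb Z^\nu$ containing the origin), and let $A\mapsto\partial A$ assign to each finite $A\subset\Gamma$ a finite subset $\partial A\subset\Gamma$, the boundary of $A$; any notion of boundary is allowed. Let $\rho$ be a pure state in case (a), or a pure even state in case (b), and let $c>0$ be a constant. If $$S_A(\rho)\le c\,|\partial A|\qquad\text{for all }A\in\mathcal F_b,$$ then $$I_\rho(A:A^c)\le 2c\,|\partial A|\qquad\text{for all }A\in\mathcal F_b .$$ -/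

import Mathlib

open scoped ComplexOrder

noncomputable section

namespace QuantumLattice

/-! ### States -/

section States

variable {𝒜 : Type*} [CStarAlgebra 𝒜]

/-- The states of a unital C*-algebra: positive normalized linear functionals. -/
def stateSpace (𝒜 : Type*) [CStarAlgebra 𝒜] : Set (𝒜 →ₗ[ℂ] ℂ) :=
  {ρ | (∀ a : 𝒜, 0 ≤ ρ (star a * a)) ∧ ρ 1 = 1}

/-- A pure state is an extreme point of the convex set of states. -/
def IsPureState (ρ : 𝒜 →ₗ[ℂ] ℂ) : Prop :=
  ρ ∈ Set.extremePoints ℝ (stateSpace 𝒜)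

end States

/-! ### The two kinds of quantum lattice systems -/

/-- A quantum spin lattice system on `Γ` with total (quasi-local) C*-algebra `𝒜`. -/
structure SpinSystem (Γ : Type*) (𝒜 : Type*) [DecidableEq Γ] [CStarAlgebra 𝒜] where
  /-- The local algebra of a finite region. -/
  loc : Finset Γ → StarSubalgebra ℂ 𝒜
  /-- Every local algebra is isomorphic to a full matrix algebra. -/
  fullMatrix : ∀ I, ∃ k : ℕ, Nonempty (loc I ≃⋆ₐ[ℂ] Matrix (Fin k) (Fin k) ℂ)
  /-- `𝒜(I ∪ J) = 𝒜(I) ⊗ 𝒜(J)` for disjoint `I`, `J`: the two factors commute, ... -/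
  commute : ∀ I J, Disjoint I J → ∀ a ∈ loc I, ∀ b ∈ loc J, Commute a b
  /-- ... the multiplication map `𝒜(I) ⊗ 𝒜(J) → 𝒜` is injective, ... -/
  linearDisjoint : ∀ I J, Disjoint I J →
    (loc I).toSubalgebra.LinearDisjoint (loc J).toSubalgebra
  /-- ... and its image is `𝒜(I ∪ J)`. -/
  union : ∀ I J, Disjoint I J → loc (I ∪ J) = loc I ⊔ loc J
  /-- The local elements are norm dense. -/
  dense : Dense (⋃ I, (loc I : Set 𝒜))

/-- The `*`-subalgebra generated by the annihilation (and creation) operators in `I`. -/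
def carLocal {Γ 𝒜 : Type*} [CStarAlgebra 𝒜] (c : Γ → 𝒜) (I : Finset Γ) :
    StarSubalgebra ℂ 𝒜 :=
  StarAlgebra.adjoin ℂ (c '' (I : Set Γ))

/-- A (spinless) fermion lattice system on `Γ` with total C*-algebra `𝒜`. -/
structure FermionSystem (Γ : Type*) (𝒜 : Type*) [DecidableEq Γ] [CStarAlgebra 𝒜] where
  /-- The annihilation operators; the creation operators are their adjoints. -/
  c : Γ → 𝒜
  /-- `{c_i^*, c_j} = δ_{ij} 1` -/
  anticomm_star : ∀ i j, star (c i) * c j + c j * star (c i) = if i = j then 1 else 0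
  /-- `{c_i, c_j} = 0`; the relation for the creation operators is its adjoint. -/
  anticomm : ∀ i j, c i * c j + c j * c i = 0
  /-- The local elements are norm dense. -/
  dense : Dense (⋃ I, (carLocal c I : Set 𝒜))

namespace FermionSystem

variable {Γ 𝒜 : Type*} [DecidableEq Γ] [CStarAlgebra 𝒜]

/-- The local algebra of a finite region. -/
def loc (F : FermionSystem Γ 𝒜) (I : Finset Γ) : StarSubalgebra ℂ 𝒜 :=
  carLocal F.c I

/-- `Θ` is the fermion grading automorphism. It is unique, as the `c i` generate `𝒜`. -/
def IsGrading (F : FermionSystem Γ 𝒜) (Θ : 𝒜 ≃⋆ₐ[ℂ] 𝒜) : Prop :=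
  ∀ i, Θ (F.c i) = -F.c i

/-- Even functionals: those invariant under the fermion grading. -/
def IsEven (F : FermionSystem Γ 𝒜) (ρ : 𝒜 →ₗ[ℂ] ℂ) : Prop :=
  ∃ Θ : 𝒜 ≃⋆ₐ[ℂ] 𝒜, F.IsGrading Θ ∧ ∀ a, ρ (Θ a) = ρ a

end FermionSystem

/-! ### Entropies -/

section Entropy

/-- `-Tr (D log D)`, with the logarithm given by the functional calculus of Hermitian
matrices and `0 log 0 = 0`. -/
def matrixEntropy {k : ℕ} (D : Matrix (Fin k) (Fin k) ℂ) : ℝ :=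
  -(Matrix.trace (D * cfc Real.log D)).re

variable {Γ 𝒜 : Type*} [DecidableEq Γ] [CStarAlgebra 𝒜]

/-- The density matrix `D` of the restriction of `ρ` to a subalgebra `B`, when `B` is
identified with a full matrix algebra by `e`; that is, `ρ x = Tr (D * e x)` for `x` in `B`. -/
def densityMatrix {B : StarSubalgebra ℂ 𝒜} {k : ℕ}
    (e : B ≃⋆ₐ[ℂ] Matrix (Fin k) (Fin k) ℂ) (ρ : 𝒜 →ₗ[ℂ] ℂ) : Matrix (Fin k) (Fin k) ℂ :=
  Matrix.of fun i j => ρ (e.symm (Matrix.single j i 1))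

/-- The defining property of the density matrix. -/
theorem apply_eq_trace_densityMatrix {B : StarSubalgebra ℂ 𝒜} {k : ℕ}
    (e : B ≃⋆ₐ[ℂ] Matrix (Fin k) (Fin k) ℂ) (ρ : 𝒜 →ₗ[ℂ] ℂ) (x : B) :
    ρ x = Matrix.trace (densityMatrix e ρ * e x) := by
  have h : ∀ M : Matrix (Fin k) (Fin k) ℂ,
      ρ (e.symm M) = Matrix.trace (densityMatrix e ρ * M) := by
    intro M
    have hs : ∀ i j, e.symm (Matrix.single i j (M i j)) =
        M i j • e.symm (Matrix.single i j 1) := by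
      intro i j
      rw [← map_smul, Matrix.smul_single, smul_eq_mul, mul_one]
    conv_lhs => rw [Matrix.matrix_eq_sum_single M]
    simp only [map_sum, hs, AddSubmonoidClass.coe_finsetSum, SetLike.val_smul, map_smul,
      smul_eq_mul, Matrix.trace, Matrix.diag, Matrix.mul_apply, densityMatrix, Matrix.of_apply]
    rw [Finset.sum_comm]
    exact Finset.sum_congr rfl fun i _ => Finset.sum_congr rfl fun j _ => mul_comm _ _
  simpa using h (e x)

open Classical in
/-- The von Neumann entropy of `ρ` on a subalgebra `B` that is isomorphic to a full matrix
algebra, as all local algebras of spin and fermion lattice systems are. The value does not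
depend on the isomorphism. -/
def vonNeumannEntropy (B : StarSubalgebra ℂ 𝒜) (ρ : 𝒜 →ₗ[ℂ] ℂ) : ℝ :=
  if h : ∃ k : ℕ, Nonempty (B ≃⋆ₐ[ℂ] Matrix (Fin k) (Fin k) ℂ) then
    matrixEntropy (densityMatrix h.choose_spec.some ρ)
  else 0

/-- The conditional entropy of `ρ` on the finite region `I` given the (finite or infinite)
region `J`: the infimum of `S_{I ∪ Λ}(ρ) - S_Λ(ρ)` over all finite `Λ ⊆ J`. -/
def conditionalEntropy (loc : Finset Γ → StarSubalgebra ℂ 𝒜) (ρ : 𝒜 →ₗ[ℂ] ℂ)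
    (I : Finset Γ) (J : Set Γ) : EReal :=
  ⨅ (Λ : Finset Γ) (_ : (Λ : Set Γ) ⊆ J),
    ((vonNeumannEntropy (loc (I ∪ Λ)) ρ - vonNeumannEntropy (loc Λ) ρ : ℝ) : EReal)

/-- The mutual entropy of `ρ` between the finite region `I` and the region `J`. -/
def mutualEntropy (loc : Finset Γ → StarSubalgebra ℂ 𝒜) (ρ : 𝒜 →ₗ[ℂ] ℂ)
    (I : Finset Γ) (J : Set Γ) : EReal :=
  (vonNeumannEntropy (loc I) ρ : EReal) - conditionalEntropy loc ρ I J

end Entropy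

end QuantumLattice

end

/-!
The entropy of any state obeys the Araki–Lieb triangle inequality `S(Λ) ≤ S(A) + S(A ∪ Λ)` for
disjoint regions `A` and `Λ`. So `S(A ∪ Λ) - S(Λ)` is at least `-S(A)`, and taking the infimum over
`Λ` shows that the mutual entropy of `A` and its complement is at most `2 S(A)`.

The triangle inequality is subadditivity applied to a purification, because `XᴴX` and `XXᴴ` have the
same nonzero eigenvalues. For subadditivity, write the density matrix in a product of eigenbases of
its marginals: by concavity of `-x log x` passing to the diagonal can only increase the entropy, and
the diagonal is a classical joint distribution with the right marginals.

The algebras of disjoint fermion regions do not commute, but a Jordan–Wigner transformation replaces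
one of them by a copy that commutes with the other one and generates the same algebra with it. The
transformation differs from the identity only on odd elements, so an even state does not see it.
-/

namespace QuantumLattice

open Real (negMulLog)

section ClassicalEntropy

theorem negMulLog_le_sub_sub_mul_log {x y : ℝ} (hx : 0 ≤ x) (hy : 0 ≤ y) (h : y = 0 → x = 0) :
    negMulLog x ≤ y - x - x * Real.log y := by
  rcases hx.eq_or_lt with rfl | hx
  · simpa using hy
  have hy' : 0 < y := hy.lt_of_ne fun h0 => hx.ne' (h h0.symm)
  have hlog : x * Real.log (y / x) ≤ y - x :=
    calc x * Real.log (y / x) ≤ x * (y / x - 1) := by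
          gcongr
          exact Real.log_le_sub_one_of_pos (div_pos hy' hx)
      _ = y - x := by field_simp
  rw [Real.log_div hy'.ne' hx.ne'] at hlog
  rw [negMulLog]
  linarith

variable {ι κ : Type*} [Fintype ι] [Fintype κ]

theorem sum_negMulLog_le_neg_sum_mul_log {q r : ι → ℝ} (hq : ∀ i, 0 ≤ q i) (hr : ∀ i, 0 ≤ r i)
    (hqr : ∀ i, r i = 0 → q i = 0) (hsum : ∑ i, r i ≤ ∑ i, q i) :
    ∑ i, negMulLog (q i) ≤ -∑ i, q i * Real.log (r i) := by
  have h : ∑ i, negMulLog (q i) ≤ ∑ i, (r i - q i - q i * Real.log (r i)) :=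
    Finset.sum_le_sum fun i _ => negMulLog_le_sub_sub_mul_log (hq i) (hr i) (hqr i)
  simp only [Finset.sum_sub_distrib] at h
  linarith

theorem sum_negMulLog_le_sum_negMulLog_marginals {q : ι × κ → ℝ} (hq : ∀ x, 0 ≤ q x)
    (hq1 : ∑ x, q x = 1) :
    ∑ x, negMulLog (q x) ≤
      ∑ a, negMulLog (∑ b, q (a, b)) + ∑ b, negMulLog (∑ a, q (a, b)) := by
  set α : ι → ℝ := fun a => ∑ b, q (a, b) with hα
  set β : κ → ℝ := fun b => ∑ a, q (a, b) with hβ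
  have hα0 (a : ι) : 0 ≤ α a := Finset.sum_nonneg fun b _ => hq (a, b)
  have hβ0 (b : κ) : 0 ≤ β b := Finset.sum_nonneg fun a _ => hq (a, b)
  have hqα (x : ι × κ) (h : α x.1 = 0) : q x = 0 :=
    (Fintype.sum_eq_zero_iff_of_nonneg fun b => hq (x.1, b)).1 h |> (congrFun · x.2)
  have hqβ (x : ι × κ) (h : β x.2 = 0) : q x = 0 :=
    (Fintype.sum_eq_zero_iff_of_nonneg fun a => hq (a, x.2)).1 h |> (congrFun · x.1)
  have hα1 : ∑ a, α a = 1 := by rw [← hq1, Fintype.sum_prod_type]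
  have hβ1 : ∑ b, β b = 1 := by rw [← hq1, Fintype.sum_prod_type_right]
  have hαβ1 : ∑ x : ι × κ, α x.1 * β x.2 = 1 := by
    rw [Fintype.sum_prod_type, ← Finset.sum_mul_sum, hα1, hβ1, one_mul]
  have hlog (x : ι × κ) :
      q x * Real.log (α x.1 * β x.2) = q x * Real.log (α x.1) + q x * Real.log (β x.2) := by
    by_cases hx : q x = 0
    · simp [hx]
    · rw [Real.log_mul (mt (hqα x) hx) (mt (hqβ x) hx), mul_add]
  calc ∑ x, negMulLog (q x) ≤ -∑ x, q x * Real.log (α x.1 * β x.2) :=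
        sum_negMulLog_le_neg_sum_mul_log hq (fun x => mul_nonneg (hα0 _) (hβ0 _))
          (fun x hx => (mul_eq_zero.1 hx).elim (hqα x) (hqβ x)) (hαβ1.trans hq1.symm).le
    _ = -∑ a, ∑ b, q (a, b) * Real.log (α a) - ∑ b, ∑ a, q (a, b) * Real.log (β b) := by
        simp_rw [hlog, Finset.sum_add_distrib, neg_add, ← sub_eq_add_neg]
        rw [Fintype.sum_prod_type, Fintype.sum_prod_type_right (fun x => q x * Real.log (β x.2))]
    _ = ∑ a, negMulLog (α a) + ∑ b, negMulLog (β b) := by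
        simp only [← Finset.sum_mul, negMulLog, neg_mul, Finset.sum_neg_distrib, hα, hβ,
          sub_eq_add_neg]

end ClassicalEntropy

section SpectralEntropy

open Matrix

variable {ι κ m n : Type*} [Fintype ι] [DecidableEq ι] [Fintype κ] [DecidableEq κ]
  [Fintype m] [DecidableEq m] [Fintype n] [DecidableEq n]

/-- The entropy `-∑ λ log λ` of a Hermitian matrix with eigenvalues `λ`. Reading the eigenvalues
off the characteristic polynomial makes its dependence on the spectrum alone evident. -/
noncomputable def spectralEntropy (D : Matrix ι ι ℂ) : ℝ :=
  (D.charpoly.roots.map fun z => negMulLog z.re).sum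

theorem spectralEntropy_eq_sum_eigenvalues {D : Matrix ι ι ℂ} (hD : D.IsHermitian) :
    spectralEntropy D = ∑ i, negMulLog (hD.eigenvalues i) := by
  rw [spectralEntropy, hD.roots_charpoly_eq_eigenvalues, Multiset.map_map]
  rfl

theorem spectralEntropy_eq_neg_trace_mul_cfc_log {D : Matrix ι ι ℂ} (hD : D.IsHermitian) :
    spectralEntropy D = -(trace (D * cfc Real.log D)).re := by
  rw [spectralEntropy_eq_sum_eigenvalues hD, hD.cfc_eq, IsHermitian.cfc]
  conv_rhs =>
    enter [1, 1, 1, 1]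
    rw [hD.spectral_theorem]
  rw [← map_mul, diagonal_mul_diagonal, Matrix.trace_map, trace_diagonal, Complex.re_sum,
    ← Finset.sum_neg_distrib]
  refine Finset.sum_congr rfl fun i _ => ?_
  simp [negMulLog]

theorem spectralEntropy_transpose (D : Matrix ι ι ℂ) :
    spectralEntropy Dᵀ = spectralEntropy D := by
  rw [spectralEntropy, spectralEntropy, charpoly_transpose]

theorem spectralEntropy_mul_comm (A : Matrix m n ℂ) (B : Matrix n m ℂ) :
    spectralEntropy (A * B) = spectralEntropy (B * A) := by
  have sum_roots_X_pow_mul (k : ℕ) {p : Polynomial ℂ} (hp : p.Monic) :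
      (((Polynomial.X ^ k * p).roots).map fun z : ℂ => negMulLog z.re).sum =
        (p.roots.map fun z => negMulLog z.re).sum := by
    rw [Polynomial.roots_mul ((Polynomial.monic_X_pow k).mul hp).ne_zero, Polynomial.roots_X_pow]
    simp [Multiset.nsmul_singleton]
  rw [spectralEntropy, spectralEntropy, ← sum_roots_X_pow_mul (Fintype.card n) (charpoly_monic _),
    charpoly_mul_comm', sum_roots_X_pow_mul _ (charpoly_monic _)]

theorem spectralEntropy_map_starAlgEquiv (φ : Matrix ι ι ℂ ≃⋆ₐ[ℂ] Matrix κ κ ℂ)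
    {D : Matrix ι ι ℂ} (hD : D.IsHermitian) : spectralEntropy (φ D) = spectralEntropy D := by
  have hφ : Continuous φ :=
    LinearMap.continuous_of_finiteDimensional (φ : Matrix ι ι ℂ →ₗ[ℂ] Matrix κ κ ℂ)
  have hφD : (φ D).IsHermitian := IsSelfAdjoint.map (f := φ) hD
  have hlog : ContinuousOn Real.log (spectrum ℝ D) := finite_real_spectrum.continuousOn _
  have map_cfc_log : cfc Real.log (φ D) = φ (cfc Real.log D) :=
    (StarAlgHomClass.map_cfc (S := ℂ) φ Real.log D hlog hφ hD hφD).symm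
  rw [spectralEntropy_eq_neg_trace_mul_cfc_log hD, spectralEntropy_eq_neg_trace_mul_cfc_log hφD,
    map_cfc_log, ← map_mul, Matrix.trace_map]

theorem spectralEntropy_unitary_conj {U : Matrix ι ι ℂ} (hU : U ∈ unitary (Matrix ι ι ℂ))
    (D : Matrix ι ι ℂ) : spectralEntropy (Uᴴ * D * U) = spectralEntropy D := by
  have hUU : U * Uᴴ = 1 := Unitary.mul_star_self_of_mem hU
  rw [spectralEntropy_mul_comm, ← Matrix.mul_assoc, hUU, Matrix.one_mul]

theorem exists_unitary_conj_eq_diagonal {D : Matrix ι ι ℂ} (hD : D.IsHermitian) :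
    ∃ U ∈ unitary (Matrix ι ι ℂ), ∃ p : ι → ℝ, Uᴴ * D * U = diagonal (fun i => (p i : ℂ)) ∧
      spectralEntropy D = ∑ i, negMulLog (p i) := by
  refine ⟨hD.eigenvectorUnitary, hD.eigenvectorUnitary.2, hD.eigenvalues, ?_,
    spectralEntropy_eq_sum_eigenvalues hD⟩
  have h := hD.conjStarAlgAut_star_eigenvectorUnitary
  rw [Unitary.conjStarAlgAut_apply, Unitary.coe_star, star_star] at h
  exact h

theorem sum_normSq_row_of_mem_unitary {U : Matrix ι ι ℂ} (hU : U ∈ unitary (Matrix ι ι ℂ))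
    (i : ι) : ∑ j, Complex.normSq (U i j) = 1 := by
  have h : (U * Uᴴ) i i = 1 := by
    rw [← star_eq_conjTranspose, Unitary.mul_star_self_of_mem hU, one_apply_eq]
  rw [mul_apply] at h
  exact Complex.ofReal_injective (by simpa [Complex.mul_conj] using h)

theorem spectralEntropy_le_sum_negMulLog_diag {D : Matrix ι ι ℂ} (hD : D.PosSemidef) :
    spectralEntropy D ≤ ∑ i, negMulLog (D i i).re := by
  set U : Matrix ι ι ℂ := ↑hD.1.eigenvectorUnitary with hU
  have hU_mem : U ∈ unitary (Matrix ι ι ℂ) := hD.1.eigenvectorUnitary.2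
  have hcol (r : ι) : ∑ i, Complex.normSq (U i r) = 1 := by
    simpa using sum_normSq_row_of_mem_unitary (Unitary.star_mem hU_mem) r
  have hdiag (i : ι) : (D i i).re = ∑ r, Complex.normSq (U i r) * hD.1.eigenvalues r := by
    conv_lhs => rw [hD.1.spectral_theorem, Unitary.conjStarAlgAut_apply, ← hU, mul_apply]
    rw [Complex.re_sum]
    refine Finset.sum_congr rfl fun r _ => ?_
    simp only [Complex.coe_algebraMap, mul_diagonal, Function.comp_apply, star_apply,
      RCLike.star_def, Complex.mul_re, Complex.ofReal_re, Complex.ofReal_im, mul_zero, sub_zero,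
      Complex.conj_re, Complex.mul_im, zero_add, Complex.conj_im, mul_neg, sub_neg_eq_add,
      Complex.normSq_apply]
    ring
  calc spectralEntropy D = ∑ r, (∑ i, Complex.normSq (U i r)) * negMulLog (hD.1.eigenvalues r) := by
        simp_rw [spectralEntropy_eq_sum_eigenvalues hD.1, hcol, one_mul]
    _ = ∑ i, ∑ r, Complex.normSq (U i r) * negMulLog (hD.1.eigenvalues r) := by
        simp_rw [Finset.sum_mul]
        exact Finset.sum_comm
    _ ≤ ∑ i, negMulLog (D i i).re := by
        refine Finset.sum_le_sum fun i _ => ?_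
        rw [hdiag]
        exact Real.concaveOn_negMulLog.le_map_sum (fun r _ => Complex.normSq_nonneg _)
          (sum_normSq_row_of_mem_unitary hU_mem i) fun r _ => hD.eigenvalues_nonneg r

end SpectralEntropy

section PartialTrace

open Matrix
open scoped Kronecker MatrixOrder Matrix.Norms.L2Operator

section CommRing

variable {R m n : Type*} [CommRing R]

/-- The partial trace over the first factor of `Rᵐ ⊗ Rⁿ`. -/
def partialTraceLeft [Fintype m] (D : Matrix (m × n) (m × n) R) : Matrix n n R :=
  of fun b b' => ∑ a, D (a, b) (a, b')

/-- The partial trace over the second factor of `Rᵐ ⊗ Rⁿ`. -/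
def partialTraceRight [Fintype n] (D : Matrix (m × n) (m × n) R) : Matrix m m R :=
  of fun a a' => ∑ b, D (a, b) (a', b)

theorem isHermitian_partialTraceLeft [StarRing R] [Fintype m] {D : Matrix (m × n) (m × n) R}
    (hD : D.IsHermitian) : (partialTraceLeft D).IsHermitian := by
  ext b b'
  simp [partialTraceLeft, hD.apply]

theorem isHermitian_partialTraceRight [StarRing R] [Fintype n] {D : Matrix (m × n) (m × n) R}
    (hD : D.IsHermitian) : (partialTraceRight D).IsHermitian := by
  ext a a'
  simp [partialTraceRight, hD.apply]

variable [Fintype m] [Fintype n]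

theorem trace_partialTraceLeft (D : Matrix (m × n) (m × n) R) :
    trace (partialTraceLeft D) = trace D := by
  simp [trace, partialTraceLeft, Fintype.sum_prod_type_right]

theorem trace_partialTraceLeft_mul [DecidableEq m] (D : Matrix (m × n) (m × n) R)
    (N : Matrix n n R) : trace (partialTraceLeft D * N) = trace (D * (1 ⊗ₖ N)) := by
  simp only [trace, diag_apply, mul_apply, partialTraceLeft, of_apply, Finset.sum_mul,
    Fintype.sum_prod_type_right, kroneckerMap_apply, one_apply, ite_mul, one_mul, zero_mul,
    mul_ite, mul_zero, Finset.sum_ite_eq', Finset.mem_univ, if_true]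
  exact Finset.sum_congr rfl fun b _ => Finset.sum_comm

theorem trace_partialTraceRight_mul [DecidableEq n] (D : Matrix (m × n) (m × n) R)
    (M : Matrix m m R) : trace (partialTraceRight D * M) = trace (D * (M ⊗ₖ 1)) := by
  simp only [trace, diag_apply, mul_apply, partialTraceRight, of_apply, Finset.sum_mul,
    Fintype.sum_prod_type, kroneckerMap_apply, one_apply, mul_one,
    mul_ite, mul_zero, Finset.sum_ite_eq', Finset.mem_univ, if_true]
  exact Finset.sum_congr rfl fun a _ => Finset.sum_comm

theorem partialTraceLeft_kronecker_conj [DecidableEq m] (D : Matrix (m × n) (m × n) R)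
    {U U' : Matrix m m R} (hU : U' * U = 1) (V V' : Matrix n n R) :
    partialTraceLeft ((U ⊗ₖ V) * D * (U' ⊗ₖ V')) = V * partialTraceLeft D * V' := by
  refine ext_iff_trace_mul_right.2 fun N => ?_
  calc trace (partialTraceLeft ((U ⊗ₖ V) * D * (U' ⊗ₖ V')) * N)
      = trace (D * ((U' ⊗ₖ V') * (1 ⊗ₖ N) * (U ⊗ₖ V))) := by
        rw [trace_partialTraceLeft_mul, Matrix.mul_assoc, Matrix.mul_assoc, trace_mul_comm,
          Matrix.mul_assoc]
    _ = trace (V * partialTraceLeft D * V' * N) := by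
        rw [← mul_kronecker_mul, ← mul_kronecker_mul, Matrix.mul_one, hU,
          ← trace_partialTraceLeft_mul, ← Matrix.mul_assoc, trace_mul_comm]
        simp only [Matrix.mul_assoc]

theorem partialTraceRight_kronecker_conj [DecidableEq n] (D : Matrix (m × n) (m × n) R)
    (U U' : Matrix m m R) {V V' : Matrix n n R} (hV : V' * V = 1) :
    partialTraceRight ((U ⊗ₖ V) * D * (U' ⊗ₖ V')) = U * partialTraceRight D * U' := by
  refine ext_iff_trace_mul_right.2 fun M => ?_
  calc trace (partialTraceRight ((U ⊗ₖ V) * D * (U' ⊗ₖ V')) * M)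
      = trace (D * ((U' ⊗ₖ V') * (M ⊗ₖ 1) * (U ⊗ₖ V))) := by
        rw [trace_partialTraceRight_mul, Matrix.mul_assoc, Matrix.mul_assoc, trace_mul_comm,
          Matrix.mul_assoc]
    _ = trace (U * partialTraceRight D * U' * M) := by
        rw [← mul_kronecker_mul, ← mul_kronecker_mul, Matrix.mul_one, hV,
          ← trace_partialTraceRight_mul, ← Matrix.mul_assoc, trace_mul_comm]
        simp only [Matrix.mul_assoc]

end CommRing

variable {m n : Type*} [Fintype m] [DecidableEq m] [Fintype n] [DecidableEq n]
  {D : Matrix (m × n) (m × n) ℂ}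

theorem spectralEntropy_le_sum_negMulLog_partialTrace_diag (hD : D.PosSemidef)
    (hD1 : trace D = 1) :
    spectralEntropy D ≤ ∑ a, negMulLog (partialTraceRight D a a).re +
      ∑ b, negMulLog (partialTraceLeft D b b).re := by
  have hq (x : m × n) : 0 ≤ (D x x).re := (Complex.nonneg_iff.1 hD.diag_nonneg).1
  have hq1 : ∑ x, (D x x).re = 1 := by
    rw [← Complex.re_sum]
    exact congrArg Complex.re hD1
  refine (spectralEntropy_le_sum_negMulLog_diag hD).trans
    ((sum_negMulLog_le_sum_negMulLog_marginals hq hq1).trans_eq ?_)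
  simp [partialTraceLeft, partialTraceRight]

theorem spectralEntropy_le_partialTraceRight_add_partialTraceLeft (hD : D.PosSemidef)
    (hD1 : trace D = 1) :
    spectralEntropy D ≤
      spectralEntropy (partialTraceRight D) + spectralEntropy (partialTraceLeft D) := by
  obtain ⟨U, hU, p, hp, hSp⟩ :=
    exists_unitary_conj_eq_diagonal (isHermitian_partialTraceRight hD.1)
  obtain ⟨V, hV, r, hr, hSr⟩ :=
    exists_unitary_conj_eq_diagonal (isHermitian_partialTraceLeft hD.1)
  have hUU : U * Uᴴ = 1 := Unitary.mul_star_self_of_mem hU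
  have hVV : V * Vᴴ = 1 := Unitary.mul_star_self_of_mem hV
  have hW : U ⊗ₖ V ∈ unitary (Matrix (m × n) (m × n) ℂ) := kronecker_mem_unitary hU hV
  set D' := (U ⊗ₖ V)ᴴ * D * (U ⊗ₖ V) with hD'
  have hD'1 : trace D' = 1 := by
    rw [hD', trace_mul_cycle, ← star_eq_conjTranspose, Unitary.mul_star_self_of_mem hW,
      Matrix.one_mul, hD1]
  have hR : partialTraceRight D' = diagonal fun a => (p a : ℂ) := by
    rw [hD', conjTranspose_kronecker, partialTraceRight_kronecker_conj _ _ _ hVV, hp]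
  have hL : partialTraceLeft D' = diagonal fun b => (r b : ℂ) := by
    rw [hD', conjTranspose_kronecker, partialTraceLeft_kronecker_conj _ hUU, hr]
  calc spectralEntropy D = spectralEntropy D' := (spectralEntropy_unitary_conj hW D).symm
    _ ≤ ∑ a, negMulLog (partialTraceRight D' a a).re +
          ∑ b, negMulLog (partialTraceLeft D' b b).re :=
        spectralEntropy_le_sum_negMulLog_partialTrace_diag
          (hD.conjTranspose_mul_mul_same _) hD'1
    _ = spectralEntropy (partialTraceRight D) + spectralEntropy (partialTraceLeft D) := by
        simp [hR, hL, hSp, hSr]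

theorem spectralEntropy_partialTraceLeft_le_partialTraceRight_add (hD : D.PosSemidef)
    (hD1 : trace D = 1) :
    spectralEntropy (partialTraceLeft D) ≤
      spectralEntropy (partialTraceRight D) + spectralEntropy D := by
  obtain ⟨Y, rfl⟩ : ∃ Y : Matrix (m × n) (m × n) ℂ, D = Yᴴ * Y :=
    CStarAlgebra.nonneg_iff_eq_star_mul_self.1 hD.nonneg
  -- `Y` is a purification of `D`, a vector with factors `m × n`, `m` and `n`; `Z` splits off `n`.
  let Z : Matrix n (m × (m × n)) ℂ := of fun b x => star (Y x.2 (x.1, b))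
  have hZ : Z * Zᴴ = partialTraceLeft (Yᴴ * Y) := by
    ext b b'
    simp [Z, mul_apply, partialTraceLeft, Fintype.sum_prod_type]
  have hZR : partialTraceRight (Zᴴ * Z) = (partialTraceRight (Yᴴ * Y))ᵀ := by
    ext a a'
    simp only [partialTraceRight, of_apply, mul_apply, conjTranspose_apply, Z, star_star,
      transpose_apply]
    rw [Finset.sum_comm]
    simp only [mul_comm]
  have hZL : partialTraceLeft (Zᴴ * Z) = Y * Yᴴ := by
    ext r r'
    simp [Z, mul_apply, partialTraceLeft, Fintype.sum_prod_type]
  have hZ1 : trace (Zᴴ * Z) = 1 := by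
    rw [trace_mul_comm, hZ, trace_partialTraceLeft, hD1]
  calc spectralEntropy (partialTraceLeft (Yᴴ * Y)) = spectralEntropy (Zᴴ * Z) := by
        rw [← hZ, spectralEntropy_mul_comm]
    _ ≤ spectralEntropy (partialTraceRight (Zᴴ * Z)) +
          spectralEntropy (partialTraceLeft (Zᴴ * Z)) :=
        spectralEntropy_le_partialTraceRight_add_partialTraceLeft
          (posSemidef_conjTranspose_mul_self Z) hZ1
    _ = spectralEntropy (partialTraceRight (Yᴴ * Y)) + spectralEntropy (Yᴴ * Y) := by
        rw [hZR, spectralEntropy_transpose, hZL, spectralEntropy_mul_comm]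

end PartialTrace

section MatrixUnits

open Matrix
open scoped Kronecker

variable {R A ι m n : Type*} [CommRing R] [StarRing R] [Ring A] [StarRing A] [Algebra R A]
  [Fintype ι] [DecidableEq ι] [Fintype m] [DecidableEq m] [Fintype n] [DecidableEq n]

/-- A system of matrix units of a unital `*`-ring. -/
structure IsMatrixUnits (u : ι → ι → A) : Prop where
  mul_eq : ∀ i j k l, u i j * u k l = if j = k then u i l else 0
  star_eq : ∀ i j, star (u i j) = u j i
  sum_diag : ∑ i, u i i = 1

theorem IsMatrixUnits.mul {u : m → m → A} {v : n → n → A} (hu : IsMatrixUnits u)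
    (hv : IsMatrixUnits v) (huv : ∀ i j k l, Commute (u i j) (v k l)) :
    IsMatrixUnits fun x y : m × n => u x.1 y.1 * v x.2 y.2 where
  mul_eq x y z w := by
    rw [(huv _ _ _ _).symm.mul_mul_mul_comm, hu.mul_eq, hv.mul_eq]
    by_cases h : y.1 = z.1 <;> simp [Prod.ext_iff, h]
  star_eq x y := by
    rw [star_mul, hu.star_eq, hv.star_eq]
    exact (huv _ _ _ _).eq.symm
  sum_diag := by
    simp only [Fintype.sum_prod_type, ← Finset.mul_sum, hu.sum_diag, hv.sum_diag, mul_one]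

theorem isMatrixUnits_map_single (f : Matrix ι ι R →⋆ₐ[R] A) :
    IsMatrixUnits fun i j => f (single i j 1) where
  mul_eq i j k l := by
    rw [← map_mul]
    split_ifs with h
    · simp [h]
    · simp [h, single_mul_single_of_ne]
  star_eq i j := by rw [← map_star, star_eq_conjTranspose, conjTranspose_single, star_one]
  sum_diag := by rw [← map_sum, sum_single_one, map_one]

theorem apply_eq_sum_smul_single (f : Matrix ι ι R →⋆ₐ[R] A) (M : Matrix ι ι R) :
    f M = ∑ i, ∑ j, M i j • f (single i j 1) := by
  conv_lhs => rw [matrix_eq_sum_single M]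
  simp only [map_sum, ← map_smul, smul_single, smul_eq_mul, mul_one]

variable [StarModule R A]

/-- The representation of the full matrix algebra defined by a system of matrix units. -/
def IsMatrixUnits.toStarAlgHom {u : ι → ι → A} (hu : IsMatrixUnits u) :
    Matrix ι ι R →⋆ₐ[R] A where
  toFun M := ∑ i, ∑ j, M i j • u i j
  map_one' := by simpa [one_apply, ite_smul] using hu.sum_diag
  map_mul' M N := by
    have h (i k : ι) :
        M i k • u i k * ∑ x, ∑ l, N x l • u x l = ∑ l, (M i k * N k l) • u i l := by
      simp [Finset.mul_sum, hu.mul_eq, smul_smul, mul_comm (M i k)]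
    simp only [Finset.sum_mul, h, mul_apply, Finset.sum_smul]
    exact Finset.sum_congr rfl fun i _ => Finset.sum_comm
  map_zero' := by simp
  map_add' M N := by simp [add_smul, Finset.sum_add_distrib]
  commutes' r := by
    simp [algebraMap_matrix_apply, ite_smul, ← Finset.smul_sum, hu.sum_diag,
      Algebra.algebraMap_eq_smul_one]
  map_star' M := by
    simp only [star_sum, star_smul, hu.star_eq, star_apply]
    exact Finset.sum_comm

theorem IsMatrixUnits.toStarAlgHom_single {u : ι → ι → A} (hu : IsMatrixUnits u) (i j : ι) :
    hu.toStarAlgHom (R := R) (single i j 1) = u i j := by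
  change ∑ k, ∑ l, single i j (1 : R) k l • u k l = u i j
  simp [single_apply, ite_and, ite_smul]

theorem range_le_of_single_mem (f : Matrix ι ι R →⋆ₐ[R] A) {S : StarSubalgebra R A}
    (h : ∀ i j, f (single i j 1) ∈ S) : f.range ≤ S := by
  rintro _ ⟨M, rfl⟩
  change f M ∈ S
  rw [apply_eq_sum_smul_single]
  exact sum_mem fun i _ => sum_mem fun j _ => S.smul_mem (h i j) _

theorem exists_starAlgHom_kronecker (f : Matrix m m R →⋆ₐ[R] A) (g : Matrix n n R →⋆ₐ[R] A)
    (hfg : ∀ a ∈ f.range, ∀ b ∈ g.range, Commute a b) :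
    ∃ h : Matrix (m × n) (m × n) R →⋆ₐ[R] A,
      (∀ M N, h (M ⊗ₖ N) = f M * g N) ∧ h.range = f.range ⊔ g.range := by
  let h : Matrix (m × n) (m × n) R →⋆ₐ[R] A :=
    ((isMatrixUnits_map_single f).mul (isMatrixUnits_map_single g)
      fun i j k l => hfg _ ⟨_, rfl⟩ _ ⟨_, rfl⟩).toStarAlgHom
  have h_single (x y : m × n) :
      h (single x y 1) = f (single x.1 y.1 1) * g (single x.2 y.2 1) :=
    IsMatrixUnits.toStarAlgHom_single _ x y
  have h_kronecker (M : Matrix m m R) (N : Matrix n n R) : h (M ⊗ₖ N) = f M * g N := by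
    rw [apply_eq_sum_smul_single f M, apply_eq_sum_smul_single g N, apply_eq_sum_smul_single h]
    simp only [h_single, kroneckerMap_apply, Fintype.sum_prod_type, Finset.sum_mul_sum,
      smul_mul_smul_comm]
  refine ⟨h, h_kronecker, le_antisymm (range_le_of_single_mem _ fun x y => ?_) (sup_le ?_ ?_)⟩
  · rw [h_single]
    exact mul_mem (StarSubalgebra.mem_sup_left ⟨_, rfl⟩) (StarSubalgebra.mem_sup_right ⟨_, rfl⟩)
  · rintro _ ⟨M, rfl⟩
    exact ⟨M ⊗ₖ 1, (h_kronecker M 1).trans (by rw [map_one, mul_one]; rfl)⟩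
  · rintro _ ⟨N, rfl⟩
    exact ⟨1 ⊗ₖ N, (h_kronecker 1 N).trans (by rw [map_one, one_mul]; rfl)⟩

end MatrixUnits

section PullbackDensity

open Matrix
open scoped MatrixOrder Matrix.Norms.L2Operator

theorem ringHom_matrix_injective {K A ι : Type*} [Field K] [Ring A] [Nontrivial A] [Fintype ι]
    [DecidableEq ι] (f : Matrix ι ι K →+* A) : Function.Injective f := by
  cases isEmpty_or_nonempty ι
  · exact Function.injective_of_subsingleton _
  · exact f.injective

variable {𝒜 ι κ : Type*} [CStarAlgebra 𝒜] [Fintype ι]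

theorem posSemidef_of_forall_trace_mul_nonneg {D : Matrix ι ι ℂ}
    (hD : ∀ M : Matrix ι ι ℂ, 0 ≤ trace (D * (Mᴴ * M))) : D.PosSemidef := by
  classical
  have hquad (v : ι → ℂ) : 0 ≤ star v ⬝ᵥ D *ᵥ v := by
    obtain ⟨M, hM⟩ : ∃ M : Matrix ι ι ℂ, vecMulVec v (star v) = Mᴴ * M :=
      CStarAlgebra.nonneg_iff_eq_star_mul_self.1 (posSemidef_vecMulVec_self_star v).nonneg
    have h := hD M
    rwa [← hM, mul_vecMulVec, trace_vecMulVec, dotProduct_comm] at h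
  rw [← isPositive_toEuclideanLin_iff, LinearMap.isPositive_iff_complex]
  intro v
  have hv : inner ℂ (D.toEuclideanLin v) v = star (star v.ofLp ⬝ᵥ D *ᵥ v.ofLp) := by
    rw [EuclideanSpace.inner_eq_star_dotProduct, ofLp_toLpLin, toLin'_apply, star_dotProduct,
      star_star, dotProduct_comm]
  obtain ⟨hre, him⟩ := Complex.nonneg_iff.1 (star_nonneg_iff.2 (hquad v.ofLp))
  rw [hv]
  exact ⟨Complex.ext rfl him, hre⟩

theorem nontrivial_of_mem_stateSpace {ρ : 𝒜 →ₗ[ℂ] ℂ} (hρ : ρ ∈ stateSpace 𝒜) :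
    Nontrivial 𝒜 := by
  refine ⟨1, 0, fun h => zero_ne_one (α := ℂ) ?_⟩
  rw [← hρ.2, h, map_zero]

variable [DecidableEq ι] [Fintype κ] [DecidableEq κ]

/-- The density matrix of the functional `ρ ∘ f` on matrices: `ρ (f M) = Tr (D M)`. -/
noncomputable def pullbackDensity (f : Matrix ι ι ℂ →⋆ₐ[ℂ] 𝒜) (ρ : 𝒜 →ₗ[ℂ] ℂ) : Matrix ι ι ℂ :=
  of fun i j => ρ (f (single j i 1))

variable (f : Matrix ι ι ℂ →⋆ₐ[ℂ] 𝒜) {ρ : 𝒜 →ₗ[ℂ] ℂ}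

theorem apply_eq_trace_pullbackDensity (ρ : 𝒜 →ₗ[ℂ] ℂ) (M : Matrix ι ι ℂ) :
    ρ (f M) = trace (pullbackDensity f ρ * M) := by
  rw [apply_eq_sum_smul_single f M, trace_mul_comm]
  simp [trace, mul_apply, pullbackDensity]

theorem trace_pullbackDensity (hρ : ρ ∈ stateSpace 𝒜) : trace (pullbackDensity f ρ) = 1 := by
  rw [← Matrix.mul_one (pullbackDensity f ρ), ← apply_eq_trace_pullbackDensity, map_one, hρ.2]

theorem posSemidef_pullbackDensity (hρ : ρ ∈ stateSpace 𝒜) :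
    (pullbackDensity f ρ).PosSemidef := by
  refine posSemidef_of_forall_trace_mul_nonneg fun M => ?_
  rw [← apply_eq_trace_pullbackDensity, ← star_eq_conjTranspose, map_mul, map_star]
  exact hρ.1 (f M)

theorem exists_starAlgEquiv_fin_of_injective (hf : Function.Injective f) :
    ∃ k : ℕ, Nonempty (f.range ≃⋆ₐ[ℂ] Matrix (Fin k) (Fin k) ℂ) :=
  ⟨Fintype.card ι, ⟨(StarAlgEquiv.ofInjective f hf).symm.trans
    (StarAlgEquiv.ofAlgEquiv (reindexAlgEquiv ℂ ℂ (Fintype.equivFin ι)) fun _ => rfl)⟩⟩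

theorem vonNeumannEntropy_range (hρ : ρ ∈ stateSpace 𝒜) :
    vonNeumannEntropy f.range ρ = spectralEntropy (pullbackDensity f ρ) := by
  have := nontrivial_of_mem_stateSpace hρ
  have hf : Function.Injective f := ringHom_matrix_injective (f : Matrix ι ι ℂ →+* 𝒜)
  rw [vonNeumannEntropy, dif_pos (exists_starAlgEquiv_fin_of_injective f hf), matrixEntropy]
  generalize (exists_starAlgEquiv_fin_of_injective f hf).choose_spec.some = e
  let φ := (StarAlgEquiv.ofInjective f hf).trans e
  have hφ : φ (pullbackDensity f ρ) = densityMatrix e ρ := by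
    refine ext_iff_trace_mul_right.2 fun N => ?_
    obtain ⟨M, rfl⟩ := φ.surjective N
    calc trace (φ (pullbackDensity f ρ) * φ M) = trace (pullbackDensity f ρ * M) := by
          rw [← map_mul, Matrix.trace_map]
      _ = ρ (f M) := (apply_eq_trace_pullbackDensity f ρ M).symm
      _ = trace (densityMatrix e ρ * φ M) :=
        apply_eq_trace_densityMatrix e ρ (StarAlgEquiv.ofInjective f hf M)
  have hD := (posSemidef_pullbackDensity f hρ).1
  have hφD : (φ (pullbackDensity f ρ)).IsHermitian := IsSelfAdjoint.map (f := φ) hD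
  rw [← hφ, ← spectralEntropy_eq_neg_trace_mul_cfc_log hφD, spectralEntropy_map_starAlgEquiv φ hD]

theorem vonNeumannEntropy_range_le_add (g : Matrix κ κ ℂ →⋆ₐ[ℂ] 𝒜)
    (hfg : ∀ a ∈ f.range, ∀ b ∈ g.range, Commute a b) (hρ : ρ ∈ stateSpace 𝒜) :
    vonNeumannEntropy g.range ρ ≤
      vonNeumannEntropy f.range ρ + vonNeumannEntropy (f.range ⊔ g.range) ρ := by
  obtain ⟨h, h_kronecker, h_range⟩ := exists_starAlgHom_kronecker f g hfg
  have hf : pullbackDensity f ρ = partialTraceRight (pullbackDensity h ρ) := by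
    refine ext_iff_trace_mul_right.2 fun M => ?_
    rw [trace_partialTraceRight_mul, ← apply_eq_trace_pullbackDensity,
      ← apply_eq_trace_pullbackDensity, h_kronecker, map_one, mul_one]
  have hg : pullbackDensity g ρ = partialTraceLeft (pullbackDensity h ρ) := by
    refine ext_iff_trace_mul_right.2 fun N => ?_
    rw [trace_partialTraceLeft_mul, ← apply_eq_trace_pullbackDensity,
      ← apply_eq_trace_pullbackDensity, h_kronecker, map_one, one_mul]
  rw [← h_range, vonNeumannEntropy_range f hρ, vonNeumannEntropy_range g hρ,
    vonNeumannEntropy_range h hρ, hf, hg]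
  exact spectralEntropy_partialTraceLeft_le_partialTraceRight_add
    (posSemidef_pullbackDensity h hρ) (trace_pullbackDensity h hρ)

end PullbackDensity

section StarAlgebra

variable {R A B : Type*} [CommRing R] [StarRing R] [Ring A] [StarRing A] [Algebra R A]
  [Ring B] [StarRing B] [Algebra R B]

/-- The representation `x ↦ p * f x + (1 - p) * g x`, for a projection `p` that commutes with the
images of both representations `f` and `g`. -/
def twist (f g : B →⋆ₐ[R] A) {p : A} (hp : IsStarProjection p) (hf : ∀ x, Commute p (f x))
    (hg : ∀ x, Commute p (g x)) : B →⋆ₐ[R] A where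
  toFun x := p * f x + (1 - p) * g x
  map_one' := by simp
  map_mul' x y := by
    have hp_compl : (1 - p) * (1 - p) = 1 - p := hp.one_sub.isIdempotentElem
    have hf_compl : Commute (f x) (1 - p) := (Commute.one_right _).sub_right (hf x).symm
    have hg_compl : Commute (g x) (1 - p) := (Commute.one_right _).sub_right (hg x).symm
    simp only [map_mul, add_mul, mul_add]
    rw [(hf x).symm.mul_mul_mul_comm, hg_compl.mul_mul_mul_comm, hf_compl.mul_mul_mul_comm,
      (hg x).symm.mul_mul_mul_comm, hp.isIdempotentElem.mul_one_sub_self,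
      hp.isIdempotentElem.one_sub_mul_self, hp.isIdempotentElem.eq, hp_compl]
    simp only [zero_mul, add_zero, zero_add]
  map_zero' := by simp
  map_add' x y := by
    simp only [map_add, mul_add]
    abel
  commutes' r := by
    rw [AlgHomClass.commutes, AlgHomClass.commutes, ← add_mul, add_sub_cancel, one_mul]
  map_star' x := by
    have hg_compl : Commute (1 - p) (g (star x)) := (Commute.one_left _).sub_left (hg _)
    rw [star_add, star_mul, star_mul, hp.isSelfAdjoint.star_eq, hp.one_sub.isSelfAdjoint.star_eq,
      ← map_star, ← map_star, (hf _).eq, hg_compl.eq]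

variable [StarModule R A]

theorem range_comp_rangeRestrict {C : Type*} [Ring C] [StarRing C] [Algebra R C] [StarModule R C]
    (f : B →⋆ₐ[R] A) (T : f.range →⋆ₐ[R] C) : (T.comp f.rangeRestrict).range = T.range := by
  ext x
  constructor
  · rintro ⟨y, rfl⟩
    exact ⟨f.rangeRestrict y, rfl⟩
  · rintro ⟨⟨_, y, rfl⟩, rfl⟩
    exact ⟨y, rfl⟩

theorem range_le_of_mem_adjoin [StarModule R B] {s : Set B} (T : StarAlgebra.adjoin R s →⋆ₐ[R] A)
    (S : StarSubalgebra R A)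
    (h : ∀ x (hx : x ∈ s), T ⟨x, StarAlgebra.subset_adjoin R s hx⟩ ∈ S) : T.range ≤ S := by
  rintro _ ⟨a, rfl⟩
  change T a ∈ S
  induction a using StarAlgebra.adjoin_induction_subtype with
  | mem x hx => exact h x hx
  | algebraMap r => exact (AlgHomClass.commutes T r).symm ▸ S.algebraMap_mem r
  | add x y hx hy => exact (map_add T x y).symm ▸ add_mem hx hy
  | mul x y hx hy => exact (map_mul T x y).symm ▸ mul_mem hx hy
  | star x hx => exact (map_star T x).symm ▸ star_mem hx

theorem commute_of_mem_adjoin {s : Set A} {x z : A}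
    (hz : ∀ y ∈ s, Commute z y ∧ Commute z (star y)) (hx : x ∈ StarAlgebra.adjoin R s) :
    Commute z x := by
  have hle : StarAlgebra.adjoin R s ≤ StarSubalgebra.centralizer R {z} := by
    refine StarAlgebra.adjoin_le fun y hy => (StarSubalgebra.mem_centralizer_iff R).2 ?_
    rintro _ rfl
    exact ⟨(hz y hy).1, commute_star_comm.2 (hz y hy).2⟩
  exact ((StarSubalgebra.mem_centralizer_iff R).1 (hle hx) z rfl).1

end StarAlgebra

theorem commute_mul_of_semiconjBy_neg {A : Type*} [Ring A] {a b x : A} (ha : SemiconjBy a x (-x))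
    (hb : SemiconjBy b x (-x)) : Commute (a * b) x := by
  have ha_neg : SemiconjBy a (-x) x := by simpa only [neg_neg] using ha.neg_right
  exact ha_neg.mul_left hb

theorem isStarProjection_half_one_add {A : Type*} [Ring A] [StarRing A] [Algebra ℂ A]
    [StarModule ℂ A] {v : A} (hv : IsSelfAdjoint v) (hvv : v * v = 1) :
    IsStarProjection ((1 / 2 : ℂ) • (1 + v)) where
  isIdempotentElem := by
    simp only [IsIdempotentElem, smul_mul_smul_comm, mul_add, add_mul, one_mul, mul_one, hvv]
    module
  isSelfAdjoint := by simp [IsSelfAdjoint, hv.star_eq]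

section FullMatrixAlgebra

variable {𝒜 : Type*} [CStarAlgebra 𝒜]

/-- The subalgebra `B` is a homomorphic image of a full matrix algebra. Unlike an isomorphism, such
an image need not be injective, which for nontrivial `𝒜` it is anyway, and the size of the matrices
is any finite type, so that products of sizes are allowed. -/
def IsFullMatrixAlgebra (B : StarSubalgebra ℂ 𝒜) : Prop :=
  ∃ (ι : Type) (_ : Fintype ι) (_ : DecidableEq ι) (f : Matrix ι ι ℂ →⋆ₐ[ℂ] 𝒜), f.range = B

theorem isFullMatrixAlgebra_of_starAlgEquiv {B : StarSubalgebra ℂ 𝒜} {k : ℕ}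
    (e : B ≃⋆ₐ[ℂ] Matrix (Fin k) (Fin k) ℂ) : IsFullMatrixAlgebra B := by
  refine ⟨Fin k, inferInstance, inferInstance,
    B.subtype.comp (e.symm : Matrix (Fin k) (Fin k) ℂ →⋆ₐ[ℂ] B), ?_⟩
  ext x
  constructor
  · rintro ⟨M, rfl⟩
    exact (e.symm M).2
  · intro hx
    exact ⟨e ⟨x, hx⟩, congrArg Subtype.val (e.symm_apply_apply ⟨x, hx⟩)⟩

namespace IsFullMatrixAlgebra

variable {B C : StarSubalgebra ℂ 𝒜}

theorem sup (hB : IsFullMatrixAlgebra B) (hC : IsFullMatrixAlgebra C)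
    (hBC : ∀ a ∈ B, ∀ b ∈ C, Commute a b) : IsFullMatrixAlgebra (B ⊔ C) := by
  obtain ⟨ι, _, _, f, rfl⟩ := hB
  obtain ⟨κ, _, _, g, rfl⟩ := hC
  obtain ⟨h, -, h_range⟩ := exists_starAlgHom_kronecker f g hBC
  exact ⟨ι × κ, inferInstance, inferInstance, h, h_range⟩

theorem range (hB : IsFullMatrixAlgebra B) (T : B →⋆ₐ[ℂ] 𝒜) : IsFullMatrixAlgebra T.range := by
  obtain ⟨ι, _, _, f, rfl⟩ := hB
  exact ⟨ι, inferInstance, inferInstance, T.comp f.rangeRestrict, range_comp_rangeRestrict f T⟩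

theorem vonNeumannEntropy_range_eq (hB : IsFullMatrixAlgebra B) (T : B →⋆ₐ[ℂ] 𝒜)
    {ρ : 𝒜 →ₗ[ℂ] ℂ} (hρ : ρ ∈ stateSpace 𝒜) (hT : ∀ x, ρ (T x) = ρ x) :
    vonNeumannEntropy T.range ρ = vonNeumannEntropy B ρ := by
  obtain ⟨ι, _, _, f, rfl⟩ := hB
  have hD : pullbackDensity (T.comp f.rangeRestrict) ρ = pullbackDensity f ρ := by
    ext i j
    exact hT _
  rw [← range_comp_rangeRestrict f T, vonNeumannEntropy_range _ hρ, hD,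
    vonNeumannEntropy_range f hρ]

theorem vonNeumannEntropy_le_add (hB : IsFullMatrixAlgebra B) (hC : IsFullMatrixAlgebra C)
    (hBC : ∀ a ∈ B, ∀ b ∈ C, Commute a b) {ρ : 𝒜 →ₗ[ℂ] ℂ} (hρ : ρ ∈ stateSpace 𝒜) :
    vonNeumannEntropy C ρ ≤ vonNeumannEntropy B ρ + vonNeumannEntropy (B ⊔ C) ρ := by
  obtain ⟨ι, _, _, f, rfl⟩ := hB
  obtain ⟨κ, _, _, g, rfl⟩ := hC
  exact vonNeumannEntropy_range_le_add f g hBC hρ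

end IsFullMatrixAlgebra

end FullMatrixAlgebra

namespace FermionSystem

variable {Γ 𝒜 : Type*} [DecidableEq Γ] [CStarAlgebra 𝒜] (F : FermionSystem Γ 𝒜)

section LocalAlgebra

variable {I J : Finset Γ}

theorem c_mem_loc {i : Γ} (hi : i ∈ I) : F.c i ∈ F.loc I :=
  StarAlgebra.subset_adjoin ℂ _ ⟨i, hi, rfl⟩

theorem loc_le {S : StarSubalgebra ℂ 𝒜} (h : ∀ i ∈ I, F.c i ∈ S) : F.loc I ≤ S := by
  refine StarAlgebra.adjoin_le ?_
  rintro _ ⟨i, hi, rfl⟩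
  exact h i hi

theorem loc_mono (h : I ⊆ J) : F.loc I ≤ F.loc J :=
  F.loc_le fun _ hi => F.c_mem_loc (h hi)

theorem range_le (T : F.loc J →⋆ₐ[ℂ] 𝒜) (S : StarSubalgebra ℂ 𝒜)
    (h : ∀ j (hj : j ∈ J), T ⟨F.c j, F.c_mem_loc hj⟩ ∈ S) : T.range ≤ S := by
  refine range_le_of_mem_adjoin T S ?_
  rintro _ ⟨j, hj, rfl⟩
  exact h j hj

theorem commute_of_mem_loc {x z : 𝒜}
    (hz : ∀ i ∈ I, Commute z (F.c i) ∧ Commute z (star (F.c i))) (hx : x ∈ F.loc I) :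
    Commute z x := by
  refine commute_of_mem_adjoin ?_ hx
  rintro _ ⟨i, hi, rfl⟩
  exact hz i hi

end LocalAlgebra

-- Anticommutation of `x` and `y` is expressed as `SemiconjBy x y (-y)`, that is `x * y = -y * x`.
theorem semiconjBy_c (i j : Γ) : SemiconjBy (F.c i) (F.c j) (-F.c j) := by
  rw [SemiconjBy, neg_mul]
  exact eq_neg_of_add_eq_zero_left (F.anticomm i j)

theorem semiconjBy_star_c {i j : Γ} (h : i ≠ j) : SemiconjBy (star (F.c i)) (F.c j) (-F.c j) := by
  rw [SemiconjBy, neg_mul]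
  exact eq_neg_of_add_eq_zero_left ((F.anticomm_star i j).trans (if_neg h))

theorem c_mul_c_self (i : Γ) : F.c i * F.c i = 0 := by
  have h := F.anticomm i i
  rw [← two_smul ℂ] at h
  exact (smul_eq_zero.1 h).resolve_left two_ne_zero

theorem star_c_mul_star_c_self (i : Γ) : star (F.c i) * star (F.c i) = 0 := by
  rw [← star_mul, c_mul_c_self, star_zero]

theorem star_c_mul_c_add_c_mul_star_c (i : Γ) :
    star (F.c i) * F.c i + F.c i * star (F.c i) = 1 :=
  (F.anticomm_star i i).trans (if_pos rfl)

theorem c_mul_star_c_mul_c (i : Γ) : F.c i * (star (F.c i) * F.c i) = F.c i := by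
  rw [eq_sub_of_add_eq (F.star_c_mul_c_add_c_mul_star_c i), mul_sub, ← mul_assoc, c_mul_c_self,
    mul_one, zero_mul, sub_zero]

theorem star_c_mul_c_mul_star_c (i : Γ) :
    star (F.c i) * (F.c i * star (F.c i)) = star (F.c i) := by
  simpa only [star_mul, star_star, mul_assoc] using congrArg star (F.c_mul_star_c_mul_c i)

theorem isMatrixUnits_c (i : Γ) :
    IsMatrixUnits ![![star (F.c i) * F.c i, star (F.c i)], ![F.c i, F.c i * star (F.c i)]] where
  mul_eq := by
    have hc (x : 𝒜) : F.c i * (F.c i * x) = 0 := by rw [← mul_assoc, c_mul_c_self, zero_mul]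
    have hc_star (x : 𝒜) : star (F.c i) * (star (F.c i) * x) = 0 := by
      rw [← mul_assoc, star_c_mul_star_c_self, zero_mul]
    simp [Fin.forall_fin_two, mul_assoc, c_mul_star_c_mul_c, star_c_mul_c_mul_star_c, c_mul_c_self,
      star_c_mul_star_c_self, hc, hc_star]
  star_eq := by simp [Fin.forall_fin_two]
  sum_diag := by simpa using F.star_c_mul_c_add_c_mul_star_c i

theorem isFullMatrixAlgebra_loc_singleton (i : Γ) : IsFullMatrixAlgebra (F.loc {i}) := by
  refine ⟨Fin 2, inferInstance, inferInstance, (F.isMatrixUnits_c i).toStarAlgHom,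
    le_antisymm (range_le_of_single_mem _ ?_) (F.loc_le fun j hj => ?_)⟩
  · intro a b
    rw [IsMatrixUnits.toStarAlgHom_single]
    have hc := F.c_mem_loc (Finset.mem_singleton_self i)
    fin_cases a <;> fin_cases b
    exacts [mul_mem (star_mem hc) hc, star_mem hc, hc, mul_mem hc (star_mem hc)]
  · rw [Finset.mem_singleton.1 hj]
    exact ⟨Matrix.single 1 0 1, (F.isMatrixUnits_c i).toStarAlgHom_single 1 0⟩

section Parity

/-- The parity operator `(-1)^n`, for the occupation number `n` of the site `i`. -/
def siteParity (i : Γ) : 𝒜 :=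
  F.c i * star (F.c i) - star (F.c i) * F.c i

theorem isSelfAdjoint_siteParity (i : Γ) : IsSelfAdjoint (F.siteParity i) := by
  simp [IsSelfAdjoint, siteParity]

theorem siteParity_mem_loc {I : Finset Γ} {i : Γ} (hi : i ∈ I) : F.siteParity i ∈ F.loc I :=
  have hc := F.c_mem_loc hi
  sub_mem (mul_mem hc (star_mem hc)) (mul_mem (star_mem hc) hc)

theorem siteParity_mul_c (i : Γ) : F.siteParity i * F.c i = F.c i := by
  rw [siteParity, sub_mul, mul_assoc, mul_assoc, c_mul_star_c_mul_c, c_mul_c_self, mul_zero,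
    sub_zero]

theorem c_mul_siteParity (i : Γ) : F.c i * F.siteParity i = -F.c i := by
  rw [siteParity, mul_sub, ← mul_assoc, c_mul_c_self, c_mul_star_c_mul_c, zero_mul, zero_sub]

theorem siteParity_mul_self (i : Γ) : F.siteParity i * F.siteParity i = 1 := by
  have h_star : F.siteParity i * star (F.c i) = -star (F.c i) := by
    simpa [(F.isSelfAdjoint_siteParity i).star_eq] using congrArg star (F.c_mul_siteParity i)
  nth_rewrite 2 [siteParity]
  rw [mul_sub, ← mul_assoc, ← mul_assoc, siteParity_mul_c, h_star, neg_mul, sub_neg_eq_add,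
    add_comm, star_c_mul_c_add_c_mul_star_c]

theorem semiconjBy_siteParity_c_self (i : Γ) :
    SemiconjBy (F.siteParity i) (F.c i) (-F.c i) := by
  rw [SemiconjBy, siteParity_mul_c, neg_mul, c_mul_siteParity, neg_neg]

theorem commute_siteParity_c {i j : Γ} (h : i ≠ j) : Commute (F.siteParity i) (F.c j) := by
  have h_star := F.semiconjBy_star_c h
  have hc := F.semiconjBy_c i j
  exact (commute_mul_of_semiconjBy_neg hc h_star).sub_left (commute_mul_of_semiconjBy_neg h_star hc)

theorem commute_siteParity_siteParity (i j : Γ) :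
    Commute (F.siteParity i) (F.siteParity j) := by
  rcases eq_or_ne i j with rfl | h
  · exact Commute.refl _
  · have hc := F.commute_siteParity_c h
    have hc_star : Commute (F.siteParity i) (star (F.c j)) := by
      simpa [(F.isSelfAdjoint_siteParity i).star_eq] using hc.star_star
    exact (hc.mul_right hc_star).sub_right (hc_star.mul_right hc)

theorem IsGrading.map_siteParity {F : FermionSystem Γ 𝒜} {Θ : 𝒜 ≃⋆ₐ[ℂ] 𝒜} (hΘ : F.IsGrading Θ)
    (i : Γ) : Θ (F.siteParity i) = F.siteParity i := by
  simp [siteParity, map_star, hΘ i]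

/-- The parity operator `(-1)^N`, for the particle number `N` of the region `I`. -/
def parity (I : Finset Γ) : 𝒜 :=
  I.noncommProd F.siteParity fun i _ j _ _ => F.commute_siteParity_siteParity i j

variable {I : Finset Γ}

theorem parity_insert {i : Γ} (hi : i ∉ I) :
    F.parity (insert i I) = F.siteParity i * F.parity I :=
  Finset.noncommProd_insert_of_notMem I i _ _ hi

theorem parity_mem_loc (I : Finset Γ) : F.parity I ∈ F.loc I :=
  Finset.noncommProd_induction I _ _ (· ∈ F.loc I) (fun _ _ => mul_mem) (one_mem _) fun _ hi =>
    F.siteParity_mem_loc hi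

theorem IsGrading.map_parity {F : FermionSystem Γ 𝒜} {Θ : 𝒜 ≃⋆ₐ[ℂ] 𝒜} (hΘ : F.IsGrading Θ)
    (I : Finset Γ) : Θ (F.parity I) = F.parity I :=
  (Finset.map_noncommProd I _ _ Θ).trans
    (Finset.noncommProd_congr rfl (fun i _ => hΘ.map_siteParity i) _)

theorem commute_siteParity_parity (i : Γ) (I : Finset Γ) :
    Commute (F.siteParity i) (F.parity I) :=
  Finset.noncommProd_commute I _ _ _ fun j _ => F.commute_siteParity_siteParity i j

theorem isSelfAdjoint_parity (I : Finset Γ) : IsSelfAdjoint (F.parity I) := by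
  induction I using Finset.induction_on with
  | empty => exact .one 𝒜
  | insert i I hi ih =>
    rw [F.parity_insert hi]
    exact ((F.isSelfAdjoint_siteParity i).commute_iff ih).1 (F.commute_siteParity_parity i I)

theorem parity_mul_self (I : Finset Γ) : F.parity I * F.parity I = 1 := by
  induction I using Finset.induction_on with
  | empty => exact one_mul 1
  | insert i I hi ih =>
    rw [F.parity_insert hi, (F.commute_siteParity_parity i I).symm.mul_mul_mul_comm,
      siteParity_mul_self, ih, one_mul]

theorem commute_parity_c {j : Γ} (hj : j ∉ I) : Commute (F.parity I) (F.c j) :=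
  (Finset.noncommProd_commute I _ _ _ fun _ hi =>
    (F.commute_siteParity_c (ne_of_mem_of_not_mem hi hj)).symm).symm

theorem semiconjBy_parity_c {i : Γ} (hi : i ∈ I) :
    SemiconjBy (F.parity I) (F.c i) (-F.c i) := by
  rw [← Finset.insert_erase hi, F.parity_insert (Finset.notMem_erase i I)]
  exact (F.semiconjBy_siteParity_c_self i).mul_left (F.commute_parity_c (Finset.notMem_erase i I))

theorem commute_parity_of_mem_loc {J : Finset Γ} (hIJ : Disjoint I J) {x : 𝒜} (hx : x ∈ F.loc J) :
    Commute (F.parity I) x := by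
  refine F.commute_of_mem_loc (fun j hj => ?_) hx
  have hc := F.commute_parity_c (Finset.disjoint_right.1 hIJ hj)
  refine ⟨hc, ?_⟩
  simpa only [(F.isSelfAdjoint_parity I).star_eq] using hc.star_star

end Parity

section JordanWigner

variable {F} {Θ : 𝒜 ≃⋆ₐ[ℂ] 𝒜} (hΘ : F.IsGrading Θ) {I J : Finset Γ} (hIJ : Disjoint I J)

theorem commute_parity_mul_c {i j : Γ} (hi : i ∈ I) (hij : i ≠ j) :
    Commute (F.parity I * F.c j) (F.c i) ∧ Commute (F.parity I * F.c j) (star (F.c i)) := by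
  have hV := (F.isSelfAdjoint_parity I).star_eq
  have hV_star : SemiconjBy (F.parity I) (star (F.c i)) (-star (F.c i)) := by
    simpa [hV] using (F.semiconjBy_parity_c hi).star_star_star.neg_right
  have hc_star : SemiconjBy (F.c j) (star (F.c i)) (-star (F.c i)) := by
    simpa using (F.semiconjBy_star_c hij.symm).star_star_star.neg_right
  exact ⟨commute_mul_of_semiconjBy_neg (F.semiconjBy_parity_c hi) (F.semiconjBy_c j i),
    commute_mul_of_semiconjBy_neg hV_star hc_star⟩

include hΘ in
theorem IsGrading.map_mem_loc {x : 𝒜} (hx : x ∈ F.loc J) : Θ x ∈ F.loc J := by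
  have hle : F.loc J ≤ (F.loc J).comap (Θ : 𝒜 →⋆ₐ[ℂ] 𝒜) := F.loc_le fun j hj => by
    change Θ (F.c j) ∈ F.loc J
    exact hΘ j ▸ neg_mem (F.c_mem_loc hj)
  exact hle hx

/-- The Jordan-Wigner transformation: the representation of the algebra of `J` that is the identity
on even elements and multiplication by the parity of the disjoint region `I` on odd ones. Its values
commute with the algebra of `I`. -/
noncomputable def jordanWigner : F.loc J →⋆ₐ[ℂ] 𝒜 :=
  twist (F.loc J).subtype ((Θ : 𝒜 →⋆ₐ[ℂ] 𝒜).comp (F.loc J).subtype)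
    (isStarProjection_half_one_add (F.isSelfAdjoint_parity I) (F.parity_mul_self I))
    (fun x => ((Commute.one_left _).add_left
      (F.commute_parity_of_mem_loc hIJ x.2)).smul_left _)
    (fun x => ((Commute.one_left _).add_left
      (F.commute_parity_of_mem_loc hIJ (hΘ.map_mem_loc x.2))).smul_left _)

theorem jordanWigner_apply (x : F.loc J) :
    jordanWigner hΘ hIJ x =
      (1 / 2 : ℂ) • (x + Θ x + F.parity I * x - F.parity I * Θ x) := by
  change (1 / 2 : ℂ) • (1 + F.parity I) * (x : 𝒜) +
    (1 - (1 / 2 : ℂ) • (1 + F.parity I)) * Θ x = _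
  simp only [smul_mul_assoc, add_mul, sub_mul, one_mul]
  module

theorem jordanWigner_c {j : Γ} (hj : j ∈ J) :
    jordanWigner hΘ hIJ ⟨F.c j, F.c_mem_loc hj⟩ = F.parity I * F.c j := by
  rw [jordanWigner_apply, hΘ j, mul_neg]
  module

theorem commute_jordanWigner {a b : 𝒜} (ha : a ∈ F.loc I) (hb : b ∈ (jordanWigner hΘ hIJ).range) :
    Commute a b := by
  have hgen {j : Γ} (hj : j ∈ J) {x : 𝒜} (hx : x ∈ F.loc I) : Commute x (F.parity I * F.c j) :=
    (F.commute_of_mem_loc (fun i hi => commute_parity_mul_c hi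
      fun h => Finset.disjoint_left.1 hIJ hi (h ▸ hj)) hx).symm
  have hle : (jordanWigner hΘ hIJ).range ≤ StarSubalgebra.centralizer ℂ (F.loc I : Set 𝒜) := by
    refine F.range_le _ _ fun j hj => (StarSubalgebra.mem_centralizer_iff ℂ).2 fun x hx => ?_
    rw [jordanWigner_c hΘ hIJ hj]
    exact ⟨hgen hj hx, hgen hj (star_mem hx)⟩
  exact ((StarSubalgebra.mem_centralizer_iff ℂ).1 (hle hb) a ha).1

theorem loc_sup_range_jordanWigner :
    F.loc I ⊔ (jordanWigner hΘ hIJ).range = F.loc (I ∪ J) := by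
  refine le_antisymm (sup_le (F.loc_mono Finset.subset_union_left) ?_) (F.loc_le fun i hi => ?_)
  · refine F.range_le _ _ fun j hj => ?_
    rw [jordanWigner_c hΘ hIJ hj]
    exact mul_mem (F.loc_mono Finset.subset_union_left (F.parity_mem_loc I))
      (F.c_mem_loc (Finset.mem_union_right I hj))
  · rcases Finset.mem_union.1 hi with hi | hi
    · exact StarSubalgebra.mem_sup_left (F.c_mem_loc hi)
    · have hc : F.c i = F.parity I * jordanWigner hΘ hIJ ⟨F.c i, F.c_mem_loc hi⟩ := by
        rw [jordanWigner_c hΘ hIJ hi, ← mul_assoc, parity_mul_self, one_mul]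
      rw [hc]
      exact mul_mem (StarSubalgebra.mem_sup_left (F.parity_mem_loc I))
        (StarSubalgebra.mem_sup_right ⟨_, rfl⟩)

theorem apply_jordanWigner {ρ : 𝒜 →ₗ[ℂ] ℂ} (hρ : ∀ a, ρ (Θ a) = ρ a) (x : F.loc J) :
    ρ (jordanWigner hΘ hIJ x) = ρ x := by
  have hV : ρ (F.parity I * Θ x) = ρ (F.parity I * x) := by
    rw [← hρ (F.parity I * x), map_mul Θ, hΘ.map_parity]
  rw [jordanWigner_apply, map_smul, map_sub, map_add, map_add, hρ, hV, smul_eq_mul]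
  ring

include hΘ in
theorem isFullMatrixAlgebra_loc (I : Finset Γ) : IsFullMatrixAlgebra (F.loc I) := by
  induction I using Finset.induction_on with
  | empty =>
    have hu : IsMatrixUnits fun _ _ : Unit => (1 : 𝒜) := ⟨by simp, by simp, by simp⟩
    refine ⟨Unit, inferInstance, inferInstance, hu.toStarAlgHom,
      le_antisymm (range_le_of_single_mem _ fun i j => ?_) (F.loc_le (by simp))⟩
    rw [hu.toStarAlgHom_single]
    exact one_mem _
  | insert i I hi ih =>
    have hdisj : Disjoint I {i} := Finset.disjoint_singleton_right.2 hi
    rw [Finset.insert_eq, Finset.union_comm, ← loc_sup_range_jordanWigner hΘ hdisj]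
    exact ih.sup ((F.isFullMatrixAlgebra_loc_singleton i).range _)
      fun _ ha _ hb => commute_jordanWigner hΘ hdisj ha hb

end JordanWigner

end FermionSystem

section MutualEntropy

variable {Γ 𝒜 : Type*} [DecidableEq Γ] [CStarAlgebra 𝒜] {ρ : 𝒜 →ₗ[ℂ] ℂ}

theorem SpinSystem.vonNeumannEntropy_le_add (Q : SpinSystem Γ 𝒜) (hρ : ρ ∈ stateSpace 𝒜)
    {I J : Finset Γ} (hIJ : Disjoint I J) :
    vonNeumannEntropy (Q.loc J) ρ ≤
      vonNeumannEntropy (Q.loc I) ρ + vonNeumannEntropy (Q.loc (I ∪ J)) ρ := by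
  have hfull (I : Finset Γ) : IsFullMatrixAlgebra (Q.loc I) :=
    let ⟨_, ⟨e⟩⟩ := Q.fullMatrix I
    isFullMatrixAlgebra_of_starAlgEquiv e
  rw [Q.union I J hIJ]
  exact (hfull I).vonNeumannEntropy_le_add (hfull J) (Q.commute I J hIJ) hρ

theorem FermionSystem.vonNeumannEntropy_le_add (F : FermionSystem Γ 𝒜) (hρ : ρ ∈ stateSpace 𝒜)
    (hρ_even : F.IsEven ρ) {I J : Finset Γ} (hIJ : Disjoint I J) :
    vonNeumannEntropy (F.loc J) ρ ≤
      vonNeumannEntropy (F.loc I) ρ + vonNeumannEntropy (F.loc (I ∪ J)) ρ := by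
  obtain ⟨Θ, hΘ, hΘρ⟩ := hρ_even
  have hI := isFullMatrixAlgebra_loc hΘ I
  have hJ := isFullMatrixAlgebra_loc hΘ J
  rw [← loc_sup_range_jordanWigner hΘ hIJ,
    ← hJ.vonNeumannEntropy_range_eq (jordanWigner hΘ hIJ) hρ (apply_jordanWigner hΘ hIJ hΘρ)]
  exact hI.vonNeumannEntropy_le_add (hJ.range _)
    (fun _ ha _ hb => commute_jordanWigner hΘ hIJ ha hb) hρ

theorem mutualEntropy_le_two_mul {loc : Finset Γ → StarSubalgebra ℂ 𝒜} {A : Finset Γ} {J : Set Γ}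
    (h : ∀ Λ : Finset Γ, (Λ : Set Γ) ⊆ J → vonNeumannEntropy (loc Λ) ρ ≤
      vonNeumannEntropy (loc A) ρ + vonNeumannEntropy (loc (A ∪ Λ)) ρ) :
    mutualEntropy loc ρ A J ≤ ((2 * vonNeumannEntropy (loc A) ρ : ℝ) : EReal) := by
  have hcond : ((-vonNeumannEntropy (loc A) ρ : ℝ) : EReal) ≤ conditionalEntropy loc ρ A J :=
    le_iInf₂ fun Λ hΛ => EReal.coe_le_coe_iff.2 (by linarith only [h Λ hΛ])
  calc mutualEntropy loc ρ A J
      ≤ (vonNeumannEntropy (loc A) ρ : EReal) - (-vonNeumannEntropy (loc A) ρ : ℝ) :=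
        EReal.sub_le_sub le_rfl hcond
    _ = ((2 * vonNeumannEntropy (loc A) ρ : ℝ) : EReal) := by
        rw [← EReal.coe_sub, sub_neg_eq_add, two_mul]

theorem mutualEntropy_compl_le {loc : Finset Γ → StarSubalgebra ℂ 𝒜} {A : Finset Γ} {s : ℝ}
    (h : ∀ {I J : Finset Γ}, Disjoint I J → vonNeumannEntropy (loc J) ρ ≤
      vonNeumannEntropy (loc I) ρ + vonNeumannEntropy (loc (I ∪ J)) ρ)
    (hA : vonNeumannEntropy (loc A) ρ ≤ s) :
    mutualEntropy loc ρ A (A : Set Γ)ᶜ ≤ ((2 * s : ℝ) : EReal) := by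
  have hdisj {Λ : Finset Γ} (hΛ : (Λ : Set Γ) ⊆ (A : Set Γ)ᶜ) : Disjoint A Λ :=
    Finset.disjoint_coe.1 (Set.subset_compl_iff_disjoint_left.1 hΛ)
  refine (mutualEntropy_le_two_mul fun Λ hΛ => h (hdisj hΛ)).trans ?_
  exact EReal.coe_le_coe_iff.2 (by gcongr)

end MutualEntropy

theorem proposition4_general {Γ 𝒜 : Type*} [DecidableEq Γ] [CStarAlgebra 𝒜]
    (Fb : Set (Finset Γ)) (bd : Finset Γ → Finset Γ) (c : ℝ) (ρ : 𝒜 →ₗ[ℂ] ℂ)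
    (hρ : ρ ∈ stateSpace 𝒜) :
    (∀ Q : SpinSystem Γ 𝒜,
      (∀ A ∈ Fb, vonNeumannEntropy (Q.loc A) ρ ≤ c * (bd A).card) →
        ∀ A ∈ Fb, mutualEntropy Q.loc ρ A (A : Set Γ)ᶜ ≤ ((2 * c * (bd A).card : ℝ) : EReal)) ∧
    (∀ F : FermionSystem Γ 𝒜, F.IsEven ρ →
      (∀ A ∈ Fb, vonNeumannEntropy (F.loc A) ρ ≤ c * (bd A).card) →
        ∀ A ∈ Fb, mutualEntropy F.loc ρ A (A : Set Γ)ᶜ ≤ ((2 * c * (bd A).card : ℝ) : EReal)) := by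
  refine ⟨fun Q h A hA => ?_, fun F hρ_even h A hA => ?_⟩ <;> rw [mul_assoc]
  · exact mutualEntropy_compl_le (Q.vonNeumannEntropy_le_add hρ) (h A hA)
  · exact mutualEntropy_compl_le (F.vonNeumannEntropy_le_add hρ hρ_even) (h A hA)

end QuantumLattice

open QuantumLattice in
/-- `Fb` is any family of finite regions, and `bd` assigns to each region its boundary, in
whatever sense: nothing is assumed of either. -/
theorem proposition4 {Γ 𝒜 : Type*} [DecidableEq Γ] [CStarAlgebra 𝒜]
    (Fb : Set (Finset Γ)) (bd : Finset Γ → Finset Γ) (c : ℝ) (hc : 0 < c) (ρ : 𝒜 →ₗ[ℂ] ℂ)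
    (hρ : IsPureState ρ) :
    (∀ Q : SpinSystem Γ 𝒜,
      (∀ A ∈ Fb, vonNeumannEntropy (Q.loc A) ρ ≤ c * (bd A).card) →
        ∀ A ∈ Fb, mutualEntropy Q.loc ρ A (A : Set Γ)ᶜ ≤ ((2 * c * (bd A).card : ℝ) : EReal)) ∧
    (∀ F : FermionSystem Γ 𝒜, F.IsEven ρ →
      (∀ A ∈ Fb, vonNeumannEntropy (F.loc A) ρ ≤ c * (bd A).card) →
        ∀ A ∈ Fb, mutualEntropy F.loc ρ A (A : Set Γ)ᶜ ≤ ((2 * c * (bd A).card : ℝ) : EReal)) :=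
  proposition4_general Fb bd c ρ hρ.1
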